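/- Let $(b_n)_{n\ge 1}$ be a sequence of real numbers. For $a\in L^\infty(\mathbb{T})$ on the unit circle $\mathbb{T}$, let $L(a)=[a_{m-n}]_{m,n\in\mathbb{Z}}$ be the Laurent matrix of the Fourier coefficients $a_n=\frac1{2\pi}\int_{-\pi}^{\pi}a(e^{i\theta})e^{-in\theta}\,d\theta$. Suppose that the doubly infinite matrix with entries $1$ on the diagonal and $-b_{|i-j|}$ at $(i,j)$, $i\ne j$, equals $L(b)$ for some $b\in L^\infty(\mathbb{T})$ (its symbol), that $b>0$ almost everywhere, and that $0$ is not in the essential range $\mathcal{R}(b)=\{\lambda\in\mathbb{C}: |\{t\in\mathbb{T}:|b(t)-\lambda|<\varepsilon\}|>0\ \ \forall\varepsilon>0\}$, where $|\cdot|$ is Lebesgue measure. Then: (1) There exists a sequence $\mathbf{X}=(X_k)_{k\in\mathbb{Z}}$ of square integrable real random variables with $\mathbb{E}X_k=0$ and $\mathbb{E}X_k^2=1$ for all $k$, such that for every $k\in\mathbb{Z}$ $$\mathbb{E}\bigl[X_k\,\big|\,\sigma(X_j: j\neq k)\bigr]=\sum_{j=1}^{\infty} b_j\,(X_{k-j}+X_{k+j}),$$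 where the series converges in $L^2$. (2) $1/b\in L^\infty(\mathbb{T})$, and $L(b)$ and $L(1/b)$ define bounded operators on $\ell^2(\mathbb{Z})$ that are inverse to each other. A centered Gaussian sequence $(X_k)_{k\in\mathbb{Z}}$ with covariance matrix $L(b)^{-1}=L(1/b)$ exists, and every such sequence is square integrable and satisfies the regression equation in (1) for every $k\in\mathbb{Z}$, with convergence in $L^2$. -/

import Mathlib

open MeasureTheory ProbabilityTheory Filter Topology
open scoped ENNReal Real

noncomputable section

/-- The unit circle `𝕋`, parametrized by the angle `θ` modulo `2π`: a function `a` on the complex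
unit circle is represented by `θ ↦ a (exp (i θ))`. -/
abbrev TorusAngle : Type := AddCircle (2 * π)

instance factTwoPiPos : Fact (0 < 2 * π) := ⟨Real.two_pi_pos⟩

/-- The Laurent matrix `L(a) = [a_{m-n}]` of the Fourier coefficients
`a_n = (1 / 2π) ∫ a(exp(iθ)) exp(-inθ) dθ` of a function `a` on the circle. -/
def laurentMatrix (a : TorusAngle → ℂ) : Matrix ℤ ℤ ℂ :=
  Matrix.of fun m n => fourierCoeff a (m - n)

/-- `a` is a symbol of the doubly infinite matrix `M`: `a` is in `L^∞(𝕋)` and `M = L(a)`. -/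
def IsSymbol (M : Matrix ℤ ℤ ℂ) (a : TorusAngle → ℂ) : Prop :=
  MemLp a ∞ (volume : Measure TorusAngle) ∧ M = laurentMatrix a

/-- The essential range of a function on the circle. -/
def circleEssRange (a : TorusAngle → ℂ) : Set ℂ :=
  {z | ∀ ε : ℝ, 0 < ε → 0 < (volume : Measure TorusAngle) {t | ‖a t - z‖ < ε}}

/-- The doubly infinite matrix with `1` on the diagonal and `-b_{|i-j|}` off the diagonal. Only the
terms `b 1, b 2, …` of the sequence are used. -/
def regressionMatrix (b : ℕ → ℝ) : Matrix ℤ ℤ ℂ :=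
  Matrix.of fun i j => if i = j then 1 else -((b (i - j).natAbs : ℝ) : ℂ)

/-- The complex Hilbert space `ℓ²(ℤ)`. -/
abbrev EllTwoInt : Type := lp (fun _ : ℤ => ℂ) 2

/-- The matrix of a bounded operator on `ℓ²(ℤ)` in the standard basis. -/
def operatorMatrix (T : EllTwoInt →L[ℂ] EllTwoInt) : Matrix ℤ ℤ ℂ :=
  Matrix.of fun m n => T (lp.single 2 n (1 : ℂ)) m

section Sequences

variable {Ω : Type*} [MeasurableSpace Ω]

/-- The sigma-algebra generated by the variables `X j` with `j ≠ k`. -/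
abbrev sigmaNe (X : ℤ → Ω → ℝ) (k : ℤ) : MeasurableSpace Ω :=
  ⨆ j : {j : ℤ // j ≠ k}, MeasurableSpace.comap (X j) (borel ℝ)

/-- A sequence of square integrable real random variables. -/
def IsSquareIntegrableSeq (X : ℤ → Ω → ℝ) (P : Measure Ω) : Prop :=
  ∀ k, Measurable (X k) ∧ MemLp (X k) 2 P

/-- A sequence of random variables with mean `0` and variance `1`. -/
def IsNormalizedSeq (X : ℤ → Ω → ℝ) (P : Measure Ω) : Prop :=
  ∀ k, ∫ ω, X k ω ∂P = 0 ∧ variance (X k) P = 1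

/-- The two-sided linear regression `E[X_k | X_j, j ≠ k] = ∑_{j ≥ 1} b_j (X_{k-j} + X_{k+j})`
for all `k`, where the series converges in `L²`. -/
def HasTwoSidedLinearRegression (b : ℕ → ℝ) (X : ℤ → Ω → ℝ) (P : Measure Ω) : Prop :=
  ∀ k : ℤ, Tendsto
    (fun N : ℕ => eLpNorm
      (fun ω => (∑ j ∈ Finset.Icc 1 N, b j * (X (k - (j : ℤ)) ω + X (k + (j : ℤ)) ω))
        - (P[X k | sigmaNe X k]) ω) 2 P)
    atTop (𝓝 0)

/-- A centered Gaussian sequence with covariance matrix `R`. -/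
structure IsCenteredGaussianSeq (X : ℤ → Ω → ℝ) (P : Measure Ω) (R : Matrix ℤ ℤ ℂ) : Prop where
  measurable : ∀ k, Measurable (X k)
  gaussian : IsGaussianProcess X P
  mean_zero : ∀ k, ∫ ω, X k ω ∂P = 0
  covariance_eq : ∀ i j, ((covariance (X i) (X j) P : ℝ) : ℂ) = R i j

end Sequences

end

/-! In the Fourier basis, `L(a)` is multiplication by `a` on `L²` of the circle. Since `0` lies
outside the essential range, `1/s` is bounded, so `T = L(s)` and `S = L(1/s)` are mutually inverse
(`laurentOp_comp_eq_id`). As `1/s ≥ 0`, `S` is the Gram matrix of the functions `e_k √(1/s)`. It is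
real because `s`, having symmetric coefficients, is even. The isonormal process turns these
functions into a Gaussian sequence with covariance `S`.

For the regression, let `x_k` be vectors with Gram matrix `S`. The entries of `e_k - T e_k` are
`b_{|m-k|}` off `k` and `0` at `k`. Boundedness of `S` makes the series `w` of the `x_m` with these
weights converge, and `S (e_k - T e_k) = S e_k - e_k` says that `⟨x_i, x_k - w⟩ = δ_{ik}`
(`exists_tendsto_two_sided_sum`). So `w` is the orthogonal projection of `x_k` on the closed span of
the other vectors. For jointly Gaussian centered variables orthogonality is independence, hence `w`
is the conditional expectation (`condExp_sigmaNe_ae_eq_of_orthogonal`). The variance is constant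
because `S` is Toeplitz, and nonzero by biorthogonality; dividing by its root normalizes the
sequence. -/

noncomputable section

/-! ### Gaussian laws under `L²` limits -/

section GaussianLimits

variable {Ω : Type*} [MeasurableSpace Ω] {P : Measure Ω}

lemma integral_norm_le_norm_Lp_two [IsProbabilityMeasure P] (f : Lp ℝ 2 P) :
    ∫ ω, ‖f ω‖ ∂P ≤ ‖f‖ := by
  have hf : MemLp f 2 P := Lp.memLp f
  have h1 : eLpNorm f 1 P ≤ eLpNorm f 2 P :=
    eLpNorm_le_eLpNorm_of_exponent_le (by norm_num) hf.1
  rw [Lp.norm_def, integral_norm_eq_lintegral_enorm hf.1, ← eLpNorm_one_eq_lintegral_enorm]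
  exact ENNReal.toReal_mono hf.2.ne h1

/-- By `|exp (iu) - 1| ≤ |u|` and `L¹ ≤ L²` on a probability space. Hence `L²` convergence forces
pointwise convergence of characteristic functions. -/
lemma norm_charFun_map_sub_le [IsProbabilityMeasure P] (f g : Lp ℝ 2 P) (t : ℝ) :
    ‖charFun (P.map f) t - charFun (P.map g) t‖ ≤ |t| * ‖f - g‖ := by
  have hf : AEMeasurable f P := (Lp.aestronglyMeasurable f).aemeasurable
  have hg : AEMeasurable g P := (Lp.aestronglyMeasurable g).aemeasurable
  have hint : ∀ {f : Ω → ℝ}, AEMeasurable f P →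
      Integrable (fun ω => Complex.exp (t * f ω * Complex.I)) P := by
    intro f hf
    refine Integrable.of_bound (C := 1) ?_ ?_
    · exact (by fun_prop : AEMeasurable (fun ω => Complex.exp (t * f ω * Complex.I)) P)
        |>.aestronglyMeasurable
    · refine ae_of_all _ fun ω => ?_
      rw [← Complex.ofReal_mul, Complex.norm_exp_ofReal_mul_I]
  rw [charFun_apply_real, charFun_apply_real, integral_map hf (by fun_prop),
    integral_map hg (by fun_prop), ← integral_sub (hint hf) (hint hg)]
  refine (norm_integral_le_integral_norm _).trans ?_
  have hfg : Integrable (f - g : Lp ℝ 2 P) P :=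
    (Lp.memLp (f - g)).integrable (by norm_num)
  calc ∫ ω, ‖Complex.exp (t * f ω * Complex.I) - Complex.exp (t * g ω * Complex.I)‖ ∂P
      ≤ ∫ ω, |t| * ‖(f - g : Lp ℝ 2 P) ω‖ ∂P := by
        refine integral_mono_ae ((hint hf).sub (hint hg)).norm (hfg.norm.const_mul _) ?_
        filter_upwards [Lp.coeFn_sub f g] with ω hω
        rw [hω, Pi.sub_apply]
        have : Complex.exp (t * f ω * Complex.I) - Complex.exp (t * g ω * Complex.I)
            = Complex.exp ((t * g ω : ℝ) * Complex.I) *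
              (Complex.exp (Complex.I * (t * (f ω - g ω) : ℝ)) - 1) := by
          rw [mul_sub, ← Complex.exp_add, mul_one]
          push_cast
          ring_nf
        rw [this, norm_mul, Complex.norm_exp_ofReal_mul_I, one_mul]
        refine Real.norm_exp_I_mul_ofReal_sub_one_le.trans ?_
        rw [norm_mul, Real.norm_eq_abs t]
    _ = |t| * ∫ ω, ‖(f - g : Lp ℝ 2 P) ω‖ ∂P := integral_const_mul _ _
    _ ≤ |t| * ‖f - g‖ :=
        mul_le_mul_of_nonneg_left (integral_norm_le_norm_Lp_two _) (abs_nonneg t)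

lemma continuous_integral_Lp_two [IsProbabilityMeasure P] :
    Continuous fun f : Lp ℝ 2 P => ∫ ω, f ω ∂P := by
  refine (LipschitzWith.of_dist_le_mul (K := 1) fun f g => ?_).continuous
  have hf : Integrable f P := (Lp.memLp f).integrable (by norm_num)
  have hg : Integrable g P := (Lp.memLp g).integrable (by norm_num)
  rw [dist_eq_norm, dist_eq_norm, ← integral_sub hf hg, NNReal.coe_one, one_mul]
  refine (norm_integral_le_integral_norm _).trans ?_
  refine le_trans (le_of_eq ?_) (integral_norm_le_norm_Lp_two (f - g))
  refine integral_congr_ae ?_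
  filter_upwards [Lp.coeFn_sub f g] with ω hω
  rw [hω, Pi.sub_apply]

lemma inner_Lp_two_eq_integral (f g : Lp ℝ 2 P) : inner ℝ f g = ∫ ω, f ω * g ω ∂P := by
  rw [L2.inner_def]
  simp [mul_comm]

lemma variance_Lp_two [IsProbabilityMeasure P] (f : Lp ℝ 2 P) :
    Var[f; P] = ‖f‖ ^ 2 - (∫ ω, f ω ∂P) ^ 2 := by
  rw [variance_eq_sub (Lp.memLp f), ← real_inner_self_eq_norm_sq, inner_Lp_two_eq_integral]
  simp [sq]

/-- A limit in `L²` of Gaussian random variables is Gaussian. -/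
lemma HasGaussianLaw.of_tendsto_Lp_two [IsProbabilityMeasure P] {ι : Type*} {l : Filter ι}
    [l.NeBot] {Y : ι → Lp ℝ 2 P} {Z : Lp ℝ 2 P} (hY : ∀ i, HasGaussianLaw (Y i) P)
    (h : Tendsto Y l (𝓝 Z)) : HasGaussianLaw Z P := by
  have hZ : AEMeasurable Z P := (Lp.aestronglyMeasurable Z).aemeasurable
  have hvar : Tendsto (fun i => Var[Y i; P]) l (𝓝 Var[Z; P]) := by
    simp_rw [variance_Lp_two]
    exact ((h.norm).pow 2).sub (((continuous_integral_Lp_two.tendsto Z).comp h).pow 2)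
  have hmean : Tendsto (fun i => ∫ ω, Y i ω ∂P) l (𝓝 (∫ ω, Z ω ∂P)) :=
    (continuous_integral_Lp_two.tendsto Z).comp h
  have key : P.map Z = gaussianReal P[Z] Var[Z; P].toNNReal := by
    have : IsProbabilityMeasure (P.map Z) := Measure.isProbabilityMeasure_map hZ
    refine Measure.ext_of_charFun (funext fun t => ?_)
    have h1 : Tendsto (fun i => charFun (P.map (Y i)) t) l (𝓝 (charFun (P.map Z) t)) := by
      rw [tendsto_iff_norm_sub_tendsto_zero]
      refine squeeze_zero (fun _ => norm_nonneg _) (fun i => norm_charFun_map_sub_le _ _ t) ?_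
      have := (tendsto_iff_norm_sub_tendsto_zero.1 h).const_mul |t|
      simpa using this
    refine tendsto_nhds_unique h1 ?_
    -- A Gaussian characteristic function depends continuously on mean and variance, and both
    -- converge under `L²` convergence.
    simp_rw [(hY _).map_eq_gaussianReal, charFun_gaussianReal,
      Real.coe_toNNReal _ (variance_nonneg _ _)]
    refine (Complex.continuous_exp.tendsto _).comp ?_
    have hm : Tendsto (fun i => ((∫ ω, Y i ω ∂P : ℝ) : ℂ)) l (𝓝 ((∫ ω, Z ω ∂P : ℝ) : ℂ)) :=
      (Complex.continuous_ofReal.tendsto _).comp hmean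
    have hv : Tendsto (fun i => ((Var[Y i; P] : ℝ) : ℂ)) l (𝓝 ((Var[Z; P] : ℝ) : ℂ)) :=
      (Complex.continuous_ofReal.tendsto _).comp hvar
    exact ((hm.const_mul _).mul_const _).sub ((hv.mul_const _).div_const _)
  constructor
  rw [key]
  infer_instance

lemma strongDual_pi_apply {κ : Type*} [Fintype κ] [DecidableEq κ] (L : StrongDual ℝ (κ → ℝ))
    (x : κ → ℝ) : L x = ∑ j, L (Pi.single j 1) * x j := by
  conv_lhs => rw [pi_eq_sum_univ' x, map_sum]
  refine Finset.sum_congr rfl fun j _ => ?_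
  rw [map_smul, smul_eq_mul, mul_comm]

lemma Lp.coeFn_sum_smul {κ : Type*} (s : Finset κ) (c : κ → ℝ) (f : κ → Lp ℝ 2 P) :
    (∑ j ∈ s, c j • f j : Lp ℝ 2 P) =ᵐ[P] fun ω => ∑ j ∈ s, c j * f j ω := by
  classical
  induction s using Finset.induction_on with
  | empty =>
    simp only [Finset.sum_empty]
    exact Lp.coeFn_zero _ _ _
  | insert a s ha ih =>
    rw [Finset.sum_insert ha]
    filter_upwards [Lp.coeFn_add (c a • f a) (∑ j ∈ s, c j • f j), Lp.coeFn_smul (c a) (f a), ih]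
      with ω h1 h2 h3
    rw [h1, Pi.add_apply, h2, h3, Finset.sum_insert ha, Pi.smul_apply, smul_eq_mul]

/-- A pointwise `L²` limit of Gaussian processes is a Gaussian process. -/
lemma IsGaussianProcess.of_tendsto_Lp_two [IsProbabilityMeasure P] {ι τ : Type*} {l : Filter ι}
    [l.NeBot] {Y : ι → τ → Lp ℝ 2 P} {Z : τ → Lp ℝ 2 P}
    (hY : ∀ i, IsGaussianProcess (fun t ω => Y i t ω) P)
    (h : ∀ t, Tendsto (fun i => Y i t) l (𝓝 (Z t))) :
    IsGaussianProcess (fun t ω => Z t ω) P := by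
  classical
  have hcomb : ∀ (X : τ → Lp ℝ 2 P) (I : Finset τ) (L : StrongDual ℝ (I → ℝ)),
      (∑ j : I, L (Pi.single j 1) • X j : Lp ℝ 2 P) =ᵐ[P]
        L ∘ fun ω => I.restrict (fun t => X t ω) := by
    intro X I L
    filter_upwards [Lp.coeFn_sum_smul Finset.univ (fun j : I => L (Pi.single j 1))
      (fun j : I => X j)] with ω hω
    rw [hω, Function.comp_apply, strongDual_pi_apply L]
    rfl
  refine ⟨fun I => ⟨?_⟩⟩
  have hmeas : AEMeasurable (fun ω => I.restrict (fun t => Z t ω)) P :=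
    aemeasurable_pi_lambda _ fun j => (Lp.aestronglyMeasurable (Z j)).aemeasurable
  -- Cramér–Wold: it suffices to treat each linear combination of finitely many coordinates, which
  -- is again an `L²` limit.
  refine isGaussian_of_isGaussian_map fun L => ?_
  rw [AEMeasurable.map_map_of_aemeasurable (by fun_prop) hmeas, ← Measure.map_congr (hcomb Z I L)]
  refine (HasGaussianLaw.of_tendsto_Lp_two (l := l)
    (Y := fun i => ∑ j : I, L (Pi.single j 1) • Y i j) (fun i => ?_) ?_).isGaussian_map
  · exact (((hY i).hasGaussianLaw I).map L).congr (hcomb (Y i) I L).symm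
  · exact tendsto_finsetSum _ fun j _ => (h j).const_smul _

end GaussianLimits

/-! ### Isonormal process -/

/-- The isonormal Gaussian process of a real Hilbert space exists. -/
theorem exists_isonormal_gaussian (H : Type) [NormedAddCommGroup H] [InnerProductSpace ℝ H]
    [CompleteSpace H] :
    ∃ (Ω : Type) (_ : MeasurableSpace Ω) (P : Measure Ω) (W : H → Ω → ℝ),
      IsProbabilityMeasure P ∧ (∀ h, Measurable (W h)) ∧ IsGaussianProcess W P ∧
        (∀ h, ∫ ω, W h ω ∂P = 0) ∧ ∀ h h', cov[W h, W h'; P] = inner ℝ h h' := by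
  classical
  obtain ⟨w, e, -⟩ := exists_hilbertBasis ℝ H
  let P : Measure (w → ℝ) := Measure.infinitePi fun _ => gaussianReal 0 1
  let ξ : w → (w → ℝ) → ℝ := fun i ω => ω i
  have hξm : ∀ i, Measurable (ξ i) := fun i => measurable_pi_apply i
  have hlaw : ∀ i, P.map (ξ i) = gaussianReal 0 1 := fun i =>
    Measure.infinitePi_map_eval (fun _ => gaussianReal 0 1) i
  have hG : ∀ i, HasGaussianLaw (ξ i) P := fun i => ⟨by rw [hlaw]; infer_instance⟩
  have hind : iIndepFun ξ P :=
    iIndepFun_infinitePi (P := fun _ => gaussianReal 0 1) (X := fun _ x => x)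
      fun _ => measurable_id
  have hξ2 : ∀ i, MemLp (ξ i) 2 P := fun i => (hG i).memLp_two
  have hmean : ∀ i, ∫ ω, ξ i ω ∂P = 0 := by
    intro i
    have := integral_map (hξm i).aemeasurable (f := fun x : ℝ => x) (μ := P) (by fun_prop)
    rw [← this, hlaw, integral_id_gaussianReal]
  have hcov : ∀ i j, ∫ ω, ξ i ω * ξ j ω ∂P = if i = j then 1 else 0 := by
    intro i j
    split_ifs with hij
    · subst hij
      have := integral_map (hξm i).aemeasurable (f := fun x : ℝ => x * x) (μ := P) (by fun_prop)
      rw [← this, hlaw]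
      have hv := variance_id_gaussianReal (μ := 0) (v := 1)
      rw [variance_eq_sub (memLp_id_gaussianReal 2)] at hv
      simpa [sq] using hv
    · have := (hind.indepFun hij).integral_mul_eq_mul_integral (hξm i).aestronglyMeasurable
        (hξm j).aestronglyMeasurable
      simpa [hmean] using this
  let x : w → Lp ℝ 2 P := fun i => (hξ2 i).toLp
  have hx : Orthonormal ℝ x := by
    rw [orthonormal_iff_ite]
    intro i j
    rw [inner_Lp_two_eq_integral, ← hcov i j]
    refine integral_congr_ae ?_
    filter_upwards [(hξ2 i).coeFn_toLp, (hξ2 j).coeFn_toLp] with ω h1 h2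
    rw [h1, h2]
  -- The isometry sends the Hilbert basis of `H` to independent standard Gaussians, so covariances
  -- equal inner products; the finite partial sums are Gaussian.
  let V : H →ₗᵢ[ℝ] Lp ℝ 2 P :=
    hx.orthogonalFamily.linearIsometry.comp e.repr.toLinearIsometry
  have hV : ∀ h, HasSum (fun i => (e.repr h i) • x i) (V h) := by
    intro h
    simpa [V] using hx.orthogonalFamily.hasSum_linearIsometry (e.repr h)
  have hVmean : ∀ h, ∫ ω, V h ω ∂P = 0 := by
    intro h
    refine tendsto_nhds_unique ((continuous_integral_Lp_two.tendsto _).comp (hV h)) ?_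
    refine tendsto_const_nhds.congr fun F => ?_
    rw [Function.comp_apply, integral_congr_ae (Lp.coeFn_sum_smul F _ _), integral_finsetSum]
    · refine (Finset.sum_eq_zero fun i _ => ?_).symm
      rw [integral_const_mul, integral_congr_ae (hξ2 i).coeFn_toLp, hmean, mul_zero]
    · intro i _
      exact ((Lp.memLp (x i)).integrable (by norm_num)).const_mul _
  have hVG : IsGaussianProcess (fun h ω => V h ω) P := by
    refine IsGaussianProcess.of_tendsto_Lp_two (l := atTop)
      (Y := fun (F : Finset w) h => ∑ i ∈ F, (e.repr h i) • x i) (fun F => ?_) hV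
    have hξG : IsGaussianProcess ξ P :=
      ⟨fun I => iIndepFun.hasGaussianLaw (fun i => hG i) (hind.precomp Subtype.val_injective)⟩
    refine IsGaussianProcess.congr (X := fun h ω => ∑ i ∈ F, e.repr h i * ξ i ω) ?_ ?_
    · refine hξG.of_isGaussianProcess fun h => ⟨F,
        ∑ i : F, (e.repr h i) • ContinuousLinearMap.proj i, fun ω => ?_⟩
      simp [← Finset.sum_coe_sort F]
    · intro h
      have h2 : ∀ᵐ ω ∂P, ∀ i ∈ F, x i ω = ξ i ω :=
        (ae_ball_iff F.countable_toSet).2 fun i _ => (hξ2 i).coeFn_toLp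
      filter_upwards [Lp.coeFn_sum_smul F (fun i => e.repr h i) x, h2] with ω h1 h2
      rw [h1]
      exact Finset.sum_congr rfl fun i hi => by rw [h2 i hi]
  have hPp : IsProbabilityMeasure P := inferInstance
  have hae : ∀ h, V h =ᵐ[P] (Lp.aestronglyMeasurable (V h)).mk := fun h =>
    (Lp.aestronglyMeasurable (V h)).ae_eq_mk
  refine ⟨w → ℝ, inferInstance, P, fun h => (Lp.aestronglyMeasurable (V h)).mk, hPp,
    fun h => (Lp.aestronglyMeasurable (V h)).stronglyMeasurable_mk.measurable,
    hVG.congr hae, fun h => ?_, fun h h' => ?_⟩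
  · rw [← integral_congr_ae (hae h), hVmean]
  · rw [covariance_eq_sub ((memLp_congr_ae (hae h)).1 (Lp.memLp _))
      ((memLp_congr_ae (hae h')).1 (Lp.memLp _)), ← integral_congr_ae (hae h), hVmean,
      ← integral_congr_ae ((hae h).mul (hae h')), ← V.inner_map_map h h', inner_Lp_two_eq_integral]
    simp

/-! ### Laurent operators as multiplication operators -/

section Laurent

open AddCircle ComplexConjugate

/-- The operator of multiplication by an essentially bounded function on `L²` of the circle. -/
def circleMul {a : TorusAngle → ℂ} (ha : MemLp a ∞ (haarAddCircle : Measure TorusAngle)) :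
    Lp ℂ 2 (haarAddCircle : Measure TorusAngle) →L[ℂ] Lp ℂ 2 (haarAddCircle : Measure TorusAngle) :=
  (ContinuousLinearMap.mul ℂ ℂ).holderL haarAddCircle ∞ 2 2 ha.toLp

lemma coeFn_circleMul {a : TorusAngle → ℂ} (ha : MemLp a ∞ (haarAddCircle : Measure TorusAngle))
    (f : Lp ℂ 2 (haarAddCircle : Measure TorusAngle)) :
    circleMul ha f =ᵐ[haarAddCircle] fun t => a t * f t := by
  have h := (ContinuousLinearMap.mul ℂ ℂ).coeFn_holder (r := 2) ha.toLp f
  filter_upwards [h, ha.coeFn_toLp] with t h1 h2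
  refine h1.trans ?_
  rw [h2]
  rfl

/-- The Laurent operator on `ℓ²(ℤ)` with an essentially bounded symbol. -/
def laurentOp {a : TorusAngle → ℂ} (ha : MemLp a ∞ (haarAddCircle : Measure TorusAngle)) :
    EllTwoInt →L[ℂ] EllTwoInt :=
  fourierBasis.repr.toLinearIsometry.toContinuousLinearMap ∘L circleMul ha ∘L
    fourierBasis.repr.symm.toLinearIsometry.toContinuousLinearMap

lemma laurentOp_apply {a : TorusAngle → ℂ}
    (ha : MemLp a ∞ (haarAddCircle : Measure TorusAngle)) (x : EllTwoInt) :
    laurentOp ha x = fourierBasis.repr (circleMul ha (fourierBasis.repr.symm x)) := rfl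

/-- Multiplication by `a` sends `e_n` to `a e_n`, whose `m`-th Fourier coefficient is that of `a` at
`m - n`. -/
lemma operatorMatrix_laurentOp {a : TorusAngle → ℂ}
    (ha : MemLp a ∞ (haarAddCircle : Measure TorusAngle)) :
    operatorMatrix (laurentOp ha) = laurentMatrix a := by
  ext m n
  simp only [operatorMatrix, laurentMatrix, Matrix.of_apply]
  rw [laurentOp_apply, HilbertBasis.repr_symm_single, fourierBasis_repr, coe_fourierBasis]
  unfold fourierCoeff
  refine integral_congr_ae ?_
  filter_upwards [coeFn_circleMul ha (fourierLp 2 n), coeFn_fourierLp 2 n] with t h1 h2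
  rw [h1, h2, neg_sub, sub_eq_add_neg, fourier_add, smul_eq_mul, smul_eq_mul]
  ring

lemma laurentOp_comp_eq_id {a a' : TorusAngle → ℂ}
    (ha : MemLp a ∞ (haarAddCircle : Measure TorusAngle))
    (ha' : MemLp a' ∞ (haarAddCircle : Measure TorusAngle))
    (h : ∀ᵐ t ∂(haarAddCircle : Measure TorusAngle), a t * a' t = 1) :
    (laurentOp ha).comp (laurentOp ha') = ContinuousLinearMap.id ℂ EllTwoInt := by
  have hmul : ∀ f, circleMul ha (circleMul ha' f) = f := by
    intro f
    refine Lp.ext ?_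
    filter_upwards [coeFn_circleMul ha (circleMul ha' f), coeFn_circleMul ha' f, h]
      with t h1 h2 h3
    rw [h1, h2, ← mul_assoc, h3, one_mul]
  refine ContinuousLinearMap.ext fun x => ?_
  rw [ContinuousLinearMap.comp_apply, laurentOp_apply, laurentOp_apply,
    LinearIsometryEquiv.symm_apply_apply, hmul, LinearIsometryEquiv.apply_symm_apply]
  rfl

lemma fourierCoeff_comp_neg (a : TorusAngle → ℂ) (n : ℤ) :
    fourierCoeff (fun t => a (-t)) n = fourierCoeff a (-n) := by
  unfold fourierCoeff
  rw [← integral_neg_eq_self]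
  refine integral_congr_ae (ae_of_all _ fun t => ?_)
  simp [fourier_apply]

lemma ae_eq_of_fourierCoeff_eq {a a' : TorusAngle → ℂ}
    (ha : MemLp a 2 (haarAddCircle : Measure TorusAngle))
    (ha' : MemLp a' 2 (haarAddCircle : Measure TorusAngle))
    (h : ∀ n, fourierCoeff a n = fourierCoeff a' n) : a =ᵐ[haarAddCircle] a' := by
  have : ha.toLp = ha'.toLp := by
    refine fourierBasis.repr.injective (lp.ext (funext fun n => ?_))
    rw [fourierBasis_repr, fourierBasis_repr, fourierCoeff_congr_ae ha.coeFn_toLp,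
      fourierCoeff_congr_ae ha'.coeFn_toLp, h]
  exact (MemLp.toLp_eq_toLp_iff ha ha').1 this

lemma conj_fourierCoeff {a : TorusAngle → ℂ}
    (ha : ∀ᵐ t ∂(haarAddCircle : Measure TorusAngle), (a t).im = 0) (n : ℤ) :
    conj (fourierCoeff a n) = fourierCoeff a (-n) := by
  unfold fourierCoeff
  rw [← integral_conj]
  refine integral_congr_ae ?_
  filter_upwards [ha] with t ht
  rw [smul_eq_mul, smul_eq_mul, map_mul, ← fourier_neg, Complex.conj_eq_iff_im.2 ht]

/-- The Toeplitz kernel of the Fourier coefficients of a nonnegative function is a Gram kernel. -/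
lemma exists_gram_fourierCoeff {a : TorusAngle → ℂ}
    (ha : Integrable a (haarAddCircle : Measure TorusAngle))
    (hpos : ∀ᵐ t ∂(haarAddCircle : Measure TorusAngle), 0 ≤ (a t).re ∧ (a t).im = 0) :
    ∃ h : ℤ → Lp ℂ 2 (haarAddCircle : Measure TorusAngle),
      ∀ i j, inner ℂ (h i) (h j) = fourierCoeff a (i - j) := by
  -- The Gram vectors are `e_k √a`: the inner product of the `i`-th and `j`-th is `∫ e_{j-i} a`.
  have hmem : ∀ k : ℤ, MemLp (fun t : TorusAngle => fourier k t * (√(a t).re : ℂ)) 2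
      haarAddCircle := by
    intro k
    have hm : AEMeasurable a (haarAddCircle : Measure TorusAngle) := ha.1.aemeasurable
    have hk : Measurable fun t : TorusAngle => fourier k t := (fourier k).continuous.measurable
    have hm' : AEMeasurable (fun t : TorusAngle => fourier k t * (√(a t).re : ℂ))
        haarAddCircle := by
      fun_prop
    rw [memLp_two_iff_integrable_sq_norm hm'.aestronglyMeasurable]
    refine ha.norm.congr ?_
    filter_upwards [hpos] with t ht
    rw [norm_mul, fourier_apply, Circle.norm_coe, one_mul, Complex.norm_real, Real.norm_eq_abs,
      sq_abs, Real.sq_sqrt ht.1]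
    conv_lhs => rw [← Complex.re_add_im (a t), ht.2]
    simp [abs_of_nonneg ht.1]
  refine ⟨fun k => (hmem k).toLp, fun i j => ?_⟩
  rw [L2.inner_def]
  unfold fourierCoeff
  refine integral_congr_ae ?_
  filter_upwards [(hmem i).coeFn_toLp, (hmem j).coeFn_toLp, hpos] with t h1 h2 h3
  have h4 : a t = (√(a t).re : ℂ) * (√(a t).re : ℂ) := by
    rw [← Complex.ofReal_mul, Real.mul_self_sqrt h3.1]
    conv_lhs => rw [← Complex.re_add_im (a t), h3.2]
    simp
  rw [h1, h2, RCLike.inner_apply, map_mul, Complex.conj_ofReal, ← fourier_neg, neg_sub,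
    sub_eq_add_neg, fourier_add, smul_eq_mul]
  conv_rhs => rw [h4]
  ring

end Laurent

/-! ### Series of vectors with a bounded Gram matrix -/

section GramSeries

variable {E : Type*} [NormedAddCommGroup E] [InnerProductSpace ℝ E]

lemma operatorMatrix_eq_inner (S : EllTwoInt →L[ℂ] EllTwoInt) (i j : ℤ) :
    operatorMatrix S i j = inner ℂ (lp.single 2 i (1 : ℂ) : EllTwoInt) (S (lp.single 2 j 1)) := by
  rw [lp.inner_single_left]
  simp [operatorMatrix]

lemma inner_sum_single_map (S : EllTwoInt →L[ℂ] EllTwoInt) {x : ℤ → E}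
    (hx : ∀ i j, ((inner ℝ (x i) (x j) : ℝ) : ℂ) = operatorMatrix S i j)
    (F : Finset ℤ) (c : ℤ → ℝ) :
    inner ℂ (∑ i ∈ F, lp.single 2 i (c i : ℂ) : EllTwoInt)
      (S (∑ i ∈ F, lp.single 2 i (c i : ℂ))) = ((‖∑ i ∈ F, c i • x i‖ ^ 2 : ℝ) : ℂ) := by
  have hs : ∀ i : ℤ, (lp.single 2 i (c i : ℂ) : EllTwoInt)
      = (c i : ℂ) • lp.single 2 i (1 : ℂ) := by
    intro i
    rw [← lp.single_smul, smul_eq_mul, mul_one]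
  rw [← real_inner_self_eq_norm_sq, sum_inner, sum_inner, map_sum, Complex.ofReal_sum]
  refine Finset.sum_congr rfl fun i _ => ?_
  rw [inner_sum, inner_sum, Complex.ofReal_sum]
  refine Finset.sum_congr rfl fun j _ => ?_
  rw [hs i, hs j, map_smul, inner_smul_left, inner_smul_right, ← operatorMatrix_eq_inner,
    ← hx, real_inner_smul_left, real_inner_smul_right]
  simp

/-- A Bessel-type bound: the left side is the quadratic form of `S` at a finitely supported vector,
controlled by Cauchy–Schwarz. -/
lemma norm_sum_smul_sq_le (S : EllTwoInt →L[ℂ] EllTwoInt) {x : ℤ → E}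
    (hx : ∀ i j, ((inner ℝ (x i) (x j) : ℝ) : ℂ) = operatorMatrix S i j)
    (F : Finset ℤ) (c : ℤ → ℝ) :
    ‖∑ i ∈ F, c i • x i‖ ^ 2 ≤ ‖S‖ * ∑ i ∈ F, c i ^ 2 := by
  set u : EllTwoInt := ∑ i ∈ F, lp.single 2 i (c i : ℂ) with hu
  have h1 : ‖u‖ ^ 2 = ∑ i ∈ F, c i ^ 2 := by
    have := lp.norm_sum_single (p := 2) (E := fun _ : ℤ => ℂ) (by norm_num)
      (fun i => (c i : ℂ)) F
    simpa using this
  have h2 := inner_sum_single_map S hx F c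
  rw [← hu] at h2
  calc ‖∑ i ∈ F, c i • x i‖ ^ 2 = ‖inner ℂ u (S u)‖ := by
        rw [h2, Complex.norm_real, Real.norm_of_nonneg (by positivity)]
    _ ≤ ‖u‖ * ‖S u‖ := norm_inner_le_norm _ _
    _ ≤ ‖u‖ * (‖S‖ * ‖u‖) := by gcongr; exact S.le_opNorm u
    _ = ‖S‖ * ∑ i ∈ F, c i ^ 2 := by rw [← h1]; ring

lemma summable_smul_of_gram [CompleteSpace E] (S : EllTwoInt →L[ℂ] EllTwoInt) {x : ℤ → E}
    (hx : ∀ i j, ((inner ℝ (x i) (x j) : ℝ) : ℂ) = operatorMatrix S i j)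
    {c : ℤ → ℝ} (hc : Summable fun i => c i ^ 2) : Summable fun i => c i • x i := by
  rw [summable_iff_vanishing_norm]
  intro ε hε
  -- The `+ 1` guards against `‖S‖ = 0`.
  have hδ : 0 < ε ^ 2 / (‖S‖ + 1) := by positivity
  obtain ⟨F, hF⟩ := summable_iff_vanishing_norm.1 hc _ hδ
  refine ⟨F, fun t ht => ?_⟩
  have h1 := hF t ht
  rw [Real.norm_of_nonneg (Finset.sum_nonneg fun i _ => sq_nonneg _),
    lt_div_iff₀ (by positivity)] at h1
  have h2 := norm_sum_smul_sq_le S hx t c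
  have h3 : 0 ≤ ∑ i ∈ t, c i ^ 2 := Finset.sum_nonneg fun i _ => sq_nonneg _
  refine lt_of_pow_lt_pow_left₀ 2 hε.le ?_
  nlinarith

/-- Both sides of the inner product formula are the sum of `c m * S i m` over `m`: one by continuity
of the inner product, the other by continuity of `S`. -/
lemma exists_hasSum_smul_of_gram [CompleteSpace E] (S : EllTwoInt →L[ℂ] EllTwoInt) {x : ℤ → E}
    (hx : ∀ i j, ((inner ℝ (x i) (x j) : ℝ) : ℂ) = operatorMatrix S i j)
    (v : EllTwoInt) {c : ℤ → ℝ} (hv : ∀ m, v m = (c m : ℂ)) :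
    ∃ w : E, HasSum (fun m => c m • x m) w ∧ ∀ i, ((inner ℝ (x i) w : ℝ) : ℂ) = S v i := by
  have hc : Summable fun i => c i ^ 2 := by
    have := (lp.memℓp v).summable (by norm_num)
    simpa [hv] using this
  obtain ⟨w, hw⟩ := summable_smul_of_gram S hx hc
  refine ⟨w, hw, fun i => ?_⟩
  have hs : ∀ m : ℤ, (lp.single 2 m (c m : ℂ) : EllTwoInt) = (c m : ℂ) • lp.single 2 m (1 : ℂ) := by
    intro m
    rw [← lp.single_smul, smul_eq_mul, mul_one]
  have h1 : HasSum (fun m => ((c m * inner ℝ (x i) (x m) : ℝ) : ℂ))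
      ((inner ℝ (x i) w : ℝ) : ℂ) := by
    have := Complex.hasSum_ofReal.2 (hw.mapL (innerSL ℝ (x i)))
    simpa only [innerSL_apply_apply, real_inner_smul_right] using this
  let L : EllTwoInt →L[ℂ] ℂ := (innerSL ℂ (lp.single 2 i (1 : ℂ) : EllTwoInt)).comp S
  have hL : ∀ u, L u = S u i := by
    intro u
    change inner ℂ (lp.single 2 i (1 : ℂ) : EllTwoInt) (S u) = S u i
    rw [lp.inner_single_left]
    simp
  have h2 : HasSum (fun m => L (lp.single 2 m (v m))) (L v) :=
    (lp.hasSum_single (by norm_num) v).mapL L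
  rw [← hL v]
  refine h1.unique (h2.congr_fun fun m => ?_)
  rw [hv, hs, map_smul, hL, Complex.ofReal_mul, hx, smul_eq_mul]
  rfl

/-- Identifies the two-sided partial sums with partial sums over intervals centered at `k`, so that
unconditional convergence over `ℤ` applies to them. -/
lemma sum_Icc_punctured_eq (b : ℕ → ℝ) (x : ℤ → E) (k : ℤ) (N : ℕ) :
    ∑ m ∈ Finset.Icc (k - N) (k + N), (if m = k then 0 else b (m - k).natAbs) • x m
      = ∑ j ∈ Finset.Icc 1 N, b j • (x (k - (j : ℤ)) + x (k + (j : ℤ))) := by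
  induction N with
  | zero => simp
  | succ N ih =>
    have h1 : Finset.Icc (k - (N + 1 : ℕ)) (k + (N + 1 : ℕ))
        = insert (k - (N + 1 : ℕ)) (insert (k + (N + 1 : ℕ)) (Finset.Icc (k - N) (k + N))) := by
      ext m
      simp only [Finset.mem_Icc, Finset.mem_insert]
      push_cast
      omega
    rw [h1, Finset.sum_insert, Finset.sum_insert, ih, Finset.sum_Icc_succ_top (by omega), smul_add]
    · have h2 : (k - ((N + 1 : ℕ) : ℤ) - k).natAbs = N + 1 := by omega
      have h3 : (k + ((N + 1 : ℕ) : ℤ) - k).natAbs = N + 1 := by omega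
      rw [h2, h3, if_neg (by omega), if_neg (by omega)]
      abel
    · simp only [Finset.mem_Icc]; push_cast; omega
    · simp only [Finset.mem_Icc, Finset.mem_insert]; push_cast; omega

lemma tendsto_Icc_int_atTop (k : ℤ) :
    Tendsto (fun N : ℕ => Finset.Icc (k - (N : ℤ)) (k + N)) atTop atTop := by
  refine tendsto_atTop_finset_of_monotone (fun M N h => ?_) fun m => ⟨(m - k).natAbs, ?_⟩
  · exact Finset.Icc_subset_Icc (by omega) (by omega)
  · rw [Finset.mem_Icc]; omega

/-- If `1 - T` has the off-diagonal entries `b_{|i-j|}` and `S` is a left inverse of `T`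
which is the Gram matrix of `x`, then the two-sided series converges, to a vector which differs
from `x k` by a vector biorthogonal to the family `x`. -/
lemma exists_tendsto_two_sided_sum [CompleteSpace E] {b : ℕ → ℝ}
    {T S : EllTwoInt →L[ℂ] EllTwoInt} (hT : operatorMatrix T = regressionMatrix b)
    (hST : S.comp T = ContinuousLinearMap.id ℂ EllTwoInt) {x : ℤ → E}
    (hx : ∀ i j, ((inner ℝ (x i) (x j) : ℝ) : ℂ) = operatorMatrix S i j) (k : ℤ) :
    ∃ w : E, Tendsto (fun N : ℕ => ∑ j ∈ Finset.Icc 1 N,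
        b j • (x (k - (j : ℤ)) + x (k + (j : ℤ)))) atTop (𝓝 w) ∧
      w ∈ (Submodule.span ℝ (x '' {j | j ≠ k})).topologicalClosure ∧
      ∀ i, inner ℝ (x i) (x k - w) = if i = k then 1 else 0 := by
  let e : EllTwoInt := lp.single 2 k (1 : ℂ)
  have he : ∀ m, e m = if m = k then 1 else 0 := by
    intro m
    simp [e, lp.single_apply, Pi.single_apply]
  let c : ℤ → ℝ := fun m => if m = k then 0 else b (m - k).natAbs
  have hv : ∀ m, (e - T e) m = (c m : ℂ) := by
    intro m
    have h1 : T e m = regressionMatrix b m k := by rw [← hT]; rfl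
    rw [lp.coeFn_sub, Pi.sub_apply, h1, he]
    by_cases hm : m = k <;> simp [regressionMatrix, c, hm]
  obtain ⟨w, hw, hwi⟩ := exists_hasSum_smul_of_gram S hx (e - T e) hv
  refine ⟨w, ?_, ?_, fun i => ?_⟩
  · refine (hw.comp (tendsto_Icc_int_atTop k)).congr fun N => ?_
    exact sum_Icc_punctured_eq b x k N
  -- The weight at `k` vanishes, so every partial sum avoids `x k`.
  · refine mem_closure_of_tendsto hw (Eventually.of_forall fun F => ?_)
    refine Submodule.sum_mem _ fun m _ => ?_
    by_cases hm : m = k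
    · simp [c, hm]
    · exact Submodule.smul_mem _ _ (Submodule.subset_span ⟨m, hm, rfl⟩)
  · have h1 : S (e - T e) = S e - e := by
      rw [map_sub]
      congr 1
      exact DFunLike.congr_fun hST e
    have h2 : (inner ℝ (x i) (x k) : ℂ) = S e i := hx i k
    apply Complex.ofReal_injective
    rw [inner_sub_right, Complex.ofReal_sub, hwi, h1, h2, lp.coeFn_sub, Pi.sub_apply, he]
    split_ifs <;> simp

end GramSeries

/-! ### Conditional expectation as orthogonal projection -/

section GaussianRegression

variable {Ω : Type*} [MeasurableSpace Ω] {P : Measure Ω}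

/-- The closed linear span in `L²` of a Gaussian process is a Gaussian process. -/
lemma IsGaussianProcess.topologicalClosure_span [IsProbabilityMeasure P] {τ : Type*}
    {x : τ → Lp ℝ 2 P} (hx : IsGaussianProcess (fun t ω => x t ω) P) :
    IsGaussianProcess
      (fun (z : (Submodule.span ℝ (Set.range x)).topologicalClosure) ω => (z : Lp ℝ 2 P) ω) P := by
  have hspan : IsGaussianProcess
      (fun (z : Submodule.span ℝ (Set.range x)) ω => (z : Lp ℝ 2 P) ω) P := by
    have h1 : ∀ z : Submodule.span ℝ (Set.range x), ∃ c : τ →₀ ℝ,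
        (c.sum fun i a => a • x i) = (z : Lp ℝ 2 P) := fun z =>
      Finsupp.mem_span_range_iff_exists_finsupp.1 z.2
    choose c hc using h1
    refine IsGaussianProcess.congr
      (X := fun (z : Submodule.span ℝ (Set.range x)) ω => ∑ i ∈ (c z).support, c z i * x i ω)
      (hx.of_isGaussianProcess fun z => ⟨(c z).support,
        ∑ i : (c z).support, (c z i) • ContinuousLinearMap.proj i, fun ω => ?_⟩) fun z => ?_
    · simp [← Finset.sum_coe_sort (c z).support]
    · rw [← hc z]
      exact (Lp.coeFn_sum_smul _ _ _).symm
  have h2 : ∀ z : (Submodule.span ℝ (Set.range x)).topologicalClosure,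
      ∃ y : ℕ → Lp ℝ 2 P, (∀ n, y n ∈ Submodule.span ℝ (Set.range x)) ∧
        Tendsto y atTop (𝓝 (z : Lp ℝ 2 P)) := fun z => mem_closure_iff_seq_limit.1 z.2
  choose y hy hyt using h2
  exact IsGaussianProcess.of_tendsto_Lp_two (l := atTop) (Y := fun n z => y z n)
    (fun n => hspan.comp_right fun z => ⟨y z n, hy z n⟩) hyt

lemma integral_eq_zero_of_mem_topologicalClosure_span [IsProbabilityMeasure P]
    {A : Set (Lp ℝ 2 P)} (hA : ∀ f ∈ A, ∫ ω, f ω ∂P = 0) {z : Lp ℝ 2 P}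
    (hz : z ∈ (Submodule.span ℝ A).topologicalClosure) : ∫ ω, z ω ∂P = 0 := by
  have hint : ∀ f : Lp ℝ 2 P, Integrable f P := fun f => (Lp.memLp f).integrable (by norm_num)
  refine closure_minimal (s := (Submodule.span ℝ A : Set (Lp ℝ 2 P)))
    (t := {f : Lp ℝ 2 P | ∫ ω, f ω ∂P = 0}) (fun f hf => ?_)
    (isClosed_eq continuous_integral_Lp_two continuous_const) hz
  induction hf using Submodule.span_induction with
  | mem f hf => exact hA f hf
  | zero =>
    change ∫ ω, (0 : Lp ℝ 2 P) ω ∂P = 0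
    rw [integral_congr_ae (Lp.coeFn_zero _ _ _)]
    simp
  | add f g _ _ hf hg =>
    change ∫ ω, (f + g : Lp ℝ 2 P) ω ∂P = 0
    rw [integral_congr_ae (Lp.coeFn_add f g)]
    simp only [Pi.add_apply]
    rw [integral_add (hint f) (hint g), hf, hg, add_zero]
  | smul a f _ hf =>
    change ∫ ω, (a • f : Lp ℝ 2 P) ω ∂P = 0
    rw [integral_congr_ae (Lp.coeFn_smul a f)]
    simp only [Pi.smul_apply]
    rw [integral_smul, hf, smul_zero]

lemma aestronglyMeasurable_of_mem_topologicalClosure_span {Ω' : Type*}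
    {m m0 : MeasurableSpace Ω'} {P : Measure Ω'} (hm : m ≤ m0)
    {A : Set (Lp ℝ 2 P)} (hA : ∀ f ∈ A, AEStronglyMeasurable[m] f P) {z : Lp ℝ 2 P}
    (hz : z ∈ (Submodule.span ℝ A).topologicalClosure) : AEStronglyMeasurable[m] z P := by
  refine closure_minimal (s := (Submodule.span ℝ A : Set (Lp ℝ 2 P)))
    (t := {f : Lp ℝ 2 P | AEStronglyMeasurable[m] f P}) (fun f hf => ?_)
    (isClosed_aestronglyMeasurable hm) hz
  have : Submodule.span ℝ A ≤ lpMeas ℝ ℝ m 2 P :=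
    Submodule.span_le.2 fun f hf => mem_lpMeas_iff_aestronglyMeasurable.2 (hA f hf)
  exact mem_lpMeas_iff_aestronglyMeasurable.1 (this hf)

/-- For a centered Gaussian process, the orthogonal projection of one variable on the closed span
of the others is the conditional expectation. -/
lemma condExp_sigmaNe_ae_eq_of_orthogonal [IsProbabilityMeasure P] {X : ℤ → Ω → ℝ}
    (hm : ∀ k, Measurable (X k)) (hX : IsGaussianProcess X P) (h0 : ∀ k, ∫ ω, X k ω ∂P = 0)
    {x : ℤ → Lp ℝ 2 P} (hx : ∀ k, x k =ᵐ[P] X k) {k : ℤ} {w : Lp ℝ 2 P}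
    (hw : w ∈ (Submodule.span ℝ (x '' {j | j ≠ k})).topologicalClosure)
    (horth : ∀ j, j ≠ k → inner ℝ (x j) (x k - w) = 0) :
    P[X k | sigmaNe X k] =ᵐ[P] w := by
  have hle : sigmaNe X k ≤ ‹MeasurableSpace Ω› := iSup_le fun j => (hm j).comap_le
  have hxG : IsGaussianProcess (fun t ω => x t ω) P := hX.congr fun t => (hx t).symm
  have hx0 : ∀ j, ∫ ω, x j ω ∂P = 0 := fun j => by rw [integral_congr_ae (hx j), h0]
  have hmono : Submodule.span ℝ (x '' {j | j ≠ k}) ≤ Submodule.span ℝ (Set.range x) :=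
    Submodule.span_mono (Set.image_subset_range _ _)
  have hin : ∀ j, x j ∈ (Submodule.span ℝ (Set.range x)).topologicalClosure := fun j =>
    Submodule.le_topologicalClosure _ (Submodule.subset_span ⟨j, rfl⟩)
  have hwin : w ∈ (Submodule.span ℝ (Set.range x)).topologicalClosure :=
    Submodule.topologicalClosure_mono hmono hw
  have hzin : x k - w ∈ (Submodule.span ℝ (Set.range x)).topologicalClosure :=
    Submodule.sub_mem _ (hin k) hwin
  set z : Lp ℝ 2 P := x k - w with hz
  have hz0 : ∫ ω, z ω ∂P = 0 := integral_eq_zero_of_mem_topologicalClosure_span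
    (by rintro _ ⟨j, rfl⟩; exact hx0 j) hzin
  obtain ⟨z', hz'm, hz'⟩ := Lp.aestronglyMeasurable z
  -- The residual must be jointly Gaussian with the other variables; this holds since all of them
  -- lie in one closed Gaussian span.
  have hG : IsGaussianProcess
      (Sum.elim (fun (_ : Unit) => z') (fun j : {j : ℤ // j ≠ k} => X j)) P := by
    have := (IsGaussianProcess.topologicalClosure_span hxG).comp_right
      (Sum.elim (fun (_ : Unit) => ⟨z, hzin⟩) (fun j : {j : ℤ // j ≠ k} => ⟨x j, hin j⟩))
    refine this.congr ?_
    rintro (_ | j)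
    · exact hz'
    · exact hx j
  have hind : IndepFun (fun ω (_ : Unit) => z' ω) (fun ω (j : {j : ℤ // j ≠ k}) => X j ω) P := by
    refine hG.indepFun_of_covariance_eq_zero (fun _ => hz'm.measurable.aemeasurable)
      (fun j => (hm j).aemeasurable) fun _ j => ?_
    have hXL : MemLp (X j) 2 P := (hX.hasGaussianLaw_eval j).memLp_two
    rw [covariance_eq_sub ((memLp_congr_ae hz').1 (Lp.memLp z)) hXL, h0, mul_zero, sub_zero,
      ← integral_congr_ae (hz'.mul (hx j)), ← horth j j.2, real_inner_comm,
      inner_Lp_two_eq_integral]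
    rfl
  have hcomap : MeasurableSpace.comap (fun ω (j : {j : ℤ // j ≠ k}) => X j ω) MeasurableSpace.pi
      = sigmaNe X k := by
    unfold MeasurableSpace.pi
    rw [MeasurableSpace.comap_iSup]
    simp_rw [MeasurableSpace.comap_comp]
    rfl
  have hz'c : P[z' | sigmaNe X k] =ᵐ[P] fun _ => 0 := by
    have hφ : Measurable fun f : Unit → ℝ => f () := measurable_pi_apply ()
    have h1 := hind.comp hφ measurable_id
    rw [IndepFun_iff_Indep] at h1
    have h2 := condExp_indep_eq (m₁ := MeasurableSpace.comap z' inferInstance)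
      (m₂ := sigmaNe X k) (μ := P) (f := z') hz'm.measurable.comap_le hle
      (comap_measurable z').stronglyMeasurable (by rw [← hcomap]; exact h1)
    rwa [← integral_congr_ae hz', hz0] at h2
  -- Measurability with respect to the sub-sigma-algebra survives `L²` limits, so conditioning fixes
  -- `w` while it kills the independent centered residual.
  have hwm : AEStronglyMeasurable[sigmaNe X k] w P := by
    refine aestronglyMeasurable_of_mem_topologicalClosure_span hle ?_ hw
    rintro _ ⟨j, hj, rfl⟩
    refine AEStronglyMeasurable.congr (f := X j) ?_ (hx j).symm
    have h1 : Measurable[sigmaNe X k] (X j) :=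
      Measurable.mono (comap_measurable (X j)) (le_iSup (fun j : {j : ℤ // j ≠ k} =>
        MeasurableSpace.comap (X j) (borel ℝ)) ⟨j, hj⟩) le_rfl
    exact h1.stronglyMeasurable.aestronglyMeasurable
  have hwint : Integrable w P := (Lp.memLp w).integrable (by norm_num)
  have hzint : Integrable z' P := ((Lp.memLp z).integrable (by norm_num)).congr hz'
  have hdecomp : X k =ᵐ[P] z' + w := by
    filter_upwards [hx k, hz', Lp.coeFn_sub (x k) w] with ω h1 h2 h3
    rw [Pi.add_apply, ← h2, hz, h3, Pi.sub_apply, h1, sub_add_cancel]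
  refine (condExp_congr_ae hdecomp).trans ((condExp_add hzint hwint _).trans ?_)
  filter_upwards [hz'c, condExp_of_aestronglyMeasurable' hle hwm hwint] with ω h1 h2
  rw [Pi.add_apply, h1, h2, zero_add]

end GaussianRegression

/-! ### Regression of the Gaussian sequence and its normalization -/

section Regression

variable {Ω : Type*} [MeasurableSpace Ω] {P : Measure Ω}

lemma IsCenteredGaussianSeq.isSquareIntegrableSeq {X : ℤ → Ω → ℝ} {R : Matrix ℤ ℤ ℂ}
    (hX : IsCenteredGaussianSeq X P R) : IsSquareIntegrableSeq X P :=
  fun k => ⟨hX.measurable k, (hX.gaussian.hasGaussianLaw_eval k).memLp_two⟩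

lemma IsCenteredGaussianSeq.exists_Lp [IsProbabilityMeasure P] {X : ℤ → Ω → ℝ} {R : Matrix ℤ ℤ ℂ}
    (hX : IsCenteredGaussianSeq X P R) :
    ∃ x : ℤ → Lp ℝ 2 P, (∀ k, x k =ᵐ[P] X k) ∧
      (∀ i j, inner ℝ (x i) (x j) = cov[X i, X j; P]) ∧
      ∀ i j, ((inner ℝ (x i) (x j) : ℝ) : ℂ) = R i j := by
  have h2 := fun k => (hX.isSquareIntegrableSeq k).2
  have h3 : ∀ i j, inner ℝ (h2 i).toLp (h2 j).toLp = cov[X i, X j; P] := by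
    intro i j
    rw [inner_Lp_two_eq_integral, covariance_eq_sub (h2 i) (h2 j), hX.mean_zero, zero_mul, sub_zero]
    exact integral_congr_ae ((h2 i).coeFn_toLp.mul (h2 j).coeFn_toLp)
  refine ⟨fun k => (h2 k).toLp, fun k => (h2 k).coeFn_toLp, h3, fun i j => ?_⟩
  rw [h3, hX.covariance_eq]

/-- A centered Gaussian sequence whose covariance is the inverse of the regression matrix has the
two-sided linear regression. -/
theorem IsCenteredGaussianSeq.hasTwoSidedLinearRegression [IsProbabilityMeasure P] {b : ℕ → ℝ}
    {T S : EllTwoInt →L[ℂ] EllTwoInt} (hT : operatorMatrix T = regressionMatrix b)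
    (hST : S.comp T = ContinuousLinearMap.id ℂ EllTwoInt) {X : ℤ → Ω → ℝ}
    (hX : IsCenteredGaussianSeq X P (operatorMatrix S)) : HasTwoSidedLinearRegression b X P := by
  obtain ⟨x, hx, -, hxR⟩ := hX.exists_Lp
  intro k
  obtain ⟨w, hlim, hspan, horth⟩ := exists_tendsto_two_sided_sum hT hST hxR k
  have hc := condExp_sigmaNe_ae_eq_of_orthogonal hX.measurable hX.gaussian hX.mean_zero hx hspan
    fun j hj => by rw [horth, if_neg hj]
  refine ((Lp.tendsto_Lp_iff_tendsto_eLpNorm' _ _).1 hlim).congr fun N => eLpNorm_congr_ae ?_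
  have hall : ∀ᵐ ω ∂P, ∀ j : ℤ, x j ω = X j ω := ae_all_iff.2 hx
  have hadd : ∀ᵐ ω ∂P, ∀ j : ℕ, (x (k - (j : ℤ)) + x (k + (j : ℤ)) : Lp ℝ 2 P) ω
      = x (k - (j : ℤ)) ω + x (k + (j : ℤ)) ω := ae_all_iff.2 fun j => Lp.coeFn_add _ _
  filter_upwards [hall, hadd, hc, Lp.coeFn_sum_smul (Finset.Icc 1 N) b
    fun j : ℕ => x (k - (j : ℤ)) + x (k + (j : ℤ))] with ω h1 h2 h3 h4
  rw [Pi.sub_apply, h4, h3]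
  simp_rw [h2, h1]

/-- Zero variance would give `x k = 0`, against `⟨x k, x k - w⟩ = 1`. -/
lemma IsCenteredGaussianSeq.variance_ne_zero [IsProbabilityMeasure P] {b : ℕ → ℝ}
    {T S : EllTwoInt →L[ℂ] EllTwoInt} (hT : operatorMatrix T = regressionMatrix b)
    (hST : S.comp T = ContinuousLinearMap.id ℂ EllTwoInt) {X : ℤ → Ω → ℝ}
    (hX : IsCenteredGaussianSeq X P (operatorMatrix S)) (k : ℤ) : Var[X k; P] ≠ 0 := by
  obtain ⟨x, -, hxc, hxR⟩ := hX.exists_Lp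
  obtain ⟨w, -, -, horth⟩ := exists_tendsto_two_sided_sum hT hST hxR k
  intro h0
  rw [← covariance_self (hX.measurable k).aemeasurable, ← hxc, inner_self_eq_zero] at h0
  simpa [h0] using horth k

lemma sigmaNe_const_mul {Ω' : Type*} (X : ℤ → Ω' → ℝ) {c : ℝ} (hc : c ≠ 0) (k : ℤ) :
    sigmaNe (fun j ω => c * X j ω) k = sigmaNe X k := by
  have h : ∀ (Y : Ω' → ℝ) (a : ℝ), MeasurableSpace.comap (fun ω => a * Y ω) (borel ℝ)
      ≤ MeasurableSpace.comap Y (borel ℝ) := by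
    intro Y a
    have h1 : Measurable[MeasurableSpace.comap Y (borel ℝ)] Y := comap_measurable Y
    exact (h1.const_mul a).comap_le
  refine iSup_congr fun j => le_antisymm (h _ c) ?_
  -- The reverse inclusion: rescaling by the inverse recovers `X j`.
  have := h (fun ω => c * X j ω) c⁻¹
  simpa [← mul_assoc, inv_mul_cancel₀ hc] using this

lemma HasTwoSidedLinearRegression.const_mul {b : ℕ → ℝ} {X : ℤ → Ω → ℝ}
    (hX : HasTwoSidedLinearRegression b X P) {c : ℝ} (hc : c ≠ 0) :
    HasTwoSidedLinearRegression b (fun k ω => c * X k ω) P := by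
  intro k
  have h1 := ENNReal.Tendsto.const_mul (a := ‖c‖ₑ) (hX k) (Or.inr enorm_ne_top)
  rw [mul_zero] at h1
  refine h1.congr fun N => ?_
  rw [← eLpNorm_const_smul]
  refine eLpNorm_congr_ae ?_
  rw [sigmaNe_const_mul X hc]
  filter_upwards [condExp_smul (μ := P) c (X k) (sigmaNe X k)] with ω h2
  have h3 : (P[fun ω => c * X k ω | sigmaNe X k]) ω = c * (P[X k | sigmaNe X k]) ω := h2
  rw [h3, Pi.smul_apply, smul_eq_mul, mul_sub, Finset.mul_sum]
  congr 1
  exact Finset.sum_congr rfl fun j _ => by ring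

/-- Normalization of a centered Gaussian sequence of constant nonzero variance. -/
lemma IsCenteredGaussianSeq.normalized {X : ℤ → Ω → ℝ} {R : Matrix ℤ ℤ ℂ}
    (hX : IsCenteredGaussianSeq X P R) {v : ℝ} (hv : 0 < v) (hvar : ∀ k, Var[X k; P] = v) :
    IsSquareIntegrableSeq (fun k ω => (√v)⁻¹ * X k ω) P ∧
      IsNormalizedSeq (fun k ω => (√v)⁻¹ * X k ω) P := by
  refine ⟨fun k => ⟨(hX.measurable k).const_mul _,
    (hX.isSquareIntegrableSeq k).2.const_mul _⟩, fun k => ⟨?_, ?_⟩⟩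
  · rw [integral_const_mul, hX.mean_zero, mul_zero]
  · rw [variance_const_mul, hvar, inv_pow, Real.sq_sqrt hv.le, inv_mul_cancel₀ hv.ne']

end Regression

/-! ### The inverse symbol and its Gaussian sequence -/

section Symbol

open AddCircle ComplexConjugate

lemma ae_haarAddCircle_iff {p : TorusAngle → Prop} :
    (∀ᵐ t ∂(haarAddCircle : Measure TorusAngle), p t) ↔
      ∀ᵐ t ∂(volume : Measure TorusAngle), p t := by
  rw [volume_eq_smul_haarAddCircle, Measure.ae_ennreal_smul_measure_iff]
  simp [Real.pi_pos]

lemma memLp_top_inv {s : TorusAngle → ℂ} (hs : MemLp s ∞ (volume : Measure TorusAngle))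
    (hess : (0 : ℂ) ∉ circleEssRange s) : MemLp s⁻¹ ∞ (volume : Measure TorusAngle) := by
  simp only [circleEssRange, Set.mem_ofPred_eq, not_forall, sub_zero, not_lt] at hess
  obtain ⟨ε, hε, h0⟩ := hess
  refine memLp_top_of_bound hs.1.aemeasurable.inv.aestronglyMeasurable ε⁻¹ ?_
  have h1 : ∀ᵐ t ∂(volume : Measure TorusAngle), ¬ ‖s t‖ < ε := by
    rw [ae_iff]
    simpa using h0
  filter_upwards [h1] with t ht
  rw [Pi.inv_apply, norm_inv]
  exact inv_anti₀ hε (not_lt.1 ht)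

lemma fourierCoeff_neg_of_isSymbol {b : ℕ → ℝ} {s : TorusAngle → ℂ}
    (hs : IsSymbol (regressionMatrix b) s) (n : ℤ) : fourierCoeff s (-n) = fourierCoeff s n := by
  have h : ∀ m : ℤ, fourierCoeff s m = regressionMatrix b m 0 := by
    intro m
    rw [hs.2]
    simp [laurentMatrix]
  rw [h, h]
  simp [regressionMatrix]

/-- A bounded function on the circle with symmetric Fourier coefficients is even. -/
lemma ae_even_of_fourierCoeff_neg {s : TorusAngle → ℂ}
    (hs : MemLp s ∞ (haarAddCircle : Measure TorusAngle))
    (h : ∀ n, fourierCoeff s (-n) = fourierCoeff s n) :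
    (fun t => s (-t)) =ᵐ[haarAddCircle] s := by
  have h2 : MemLp s 2 (haarAddCircle : Measure TorusAngle) := hs.mono_exponent le_top
  refine ae_eq_of_fourierCoeff_eq ?_ h2 fun n => ?_
  · exact h2.comp_measurePreserving (Measure.measurePreserving_neg _)
  · rw [fourierCoeff_comp_neg, h]

/-- For a real function conjugation reflects the index, and evenness undoes the reflection. -/
lemma fourierCoeff_im_eq_zero {a : TorusAngle → ℂ}
    (ha : ∀ᵐ t ∂(haarAddCircle : Measure TorusAngle), (a t).im = 0)
    (heven : (fun t => a (-t)) =ᵐ[haarAddCircle] a) (n : ℤ) : (fourierCoeff a n).im = 0 := by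
  rw [← Complex.conj_eq_iff_im, conj_fourierCoeff ha, ← fourierCoeff_comp_neg,
    fourierCoeff_congr_ae heven]

/-- For a nonnegative integrable symbol with real Fourier coefficients, a centered Gaussian sequence
whose covariance is the Laurent matrix of the symbol exists. -/
theorem exists_isCenteredGaussianSeq_laurentMatrix {a : TorusAngle → ℂ}
    (ha : Integrable a (haarAddCircle : Measure TorusAngle))
    (hpos : ∀ᵐ t ∂(haarAddCircle : Measure TorusAngle), 0 ≤ (a t).re ∧ (a t).im = 0)
    (hreal : ∀ n, (fourierCoeff a n).im = 0) :
    ∃ (Ω : Type) (_ : MeasurableSpace Ω) (P : Measure Ω) (X : ℤ → Ω → ℝ),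
      IsProbabilityMeasure P ∧ IsCenteredGaussianSeq X P (laurentMatrix a) := by
  obtain ⟨h, hh⟩ := exists_gram_fourierCoeff ha hpos
  obtain ⟨Ω, mΩ, P, W, hP, hWm, hWG, hW0, hWc⟩ :=
    @exists_isonormal_gaussian (Lp ℂ 2 (haarAddCircle : Measure TorusAngle)) _
      (InnerProductSpace.rclikeToReal ℂ _) _
  refine ⟨Ω, mΩ, P, fun k => W (h k), hP, fun k => hWm _, hWG.comp_right h, fun k => hW0 _,
    fun i j => ?_⟩
  -- The real inner product on complex `L²` is the real part of the complex one; nothing is lost, as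
  -- the coefficients are real.
  have h1 : cov[W (h i), W (h j); P] = (fourierCoeff a (i - j)).re := by
    rw [hWc, ← hh]
    rfl
  rw [h1, laurentMatrix, Matrix.of_apply]
  apply Complex.ext <;> simp [hreal]

end Symbol

end

/-! ### Assembly of the result -/

theorem proposition1 (b : ℕ → ℝ) (s : TorusAngle → ℂ)
    (hs : IsSymbol (regressionMatrix b) s)
    (hpos : ∀ᵐ t ∂(volume : Measure TorusAngle), 0 < (s t).re ∧ (s t).im = 0)
    (hess : (0 : ℂ) ∉ circleEssRange s) :
    -- a normalized square integrable sequence with the two-sided linear regression exists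
    (∃ (Ω : Type) (_ : MeasurableSpace Ω) (P : Measure Ω) (X : ℤ → Ω → ℝ),
      IsProbabilityMeasure P ∧ IsSquareIntegrableSeq X P ∧ IsNormalizedSeq X P ∧
        HasTwoSidedLinearRegression b X P) ∧
    -- `L(s)` is a bounded operator with bounded inverse `L(1 / s)`
    (MemLp s⁻¹ ∞ (volume : Measure TorusAngle) ∧
      ∃ T S : EllTwoInt →L[ℂ] EllTwoInt,
        operatorMatrix T = regressionMatrix b ∧ operatorMatrix S = laurentMatrix s⁻¹ ∧
          T.comp S = ContinuousLinearMap.id ℂ EllTwoInt ∧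
          S.comp T = ContinuousLinearMap.id ℂ EllTwoInt) ∧
    -- the centered Gaussian sequence with covariance `L(1 / s)` exists
    (∃ (Ω : Type) (_ : MeasurableSpace Ω) (P : Measure Ω) (X : ℤ → Ω → ℝ),
      IsProbabilityMeasure P ∧ IsCenteredGaussianSeq X P (laurentMatrix s⁻¹)) ∧
    -- and each such sequence is square integrable and has the two-sided linear regression
    (∀ (Ω : Type*) [MeasurableSpace Ω] (P : Measure Ω) [IsProbabilityMeasure P]
      (X : ℤ → Ω → ℝ), IsCenteredGaussianSeq X P (laurentMatrix s⁻¹) →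
        IsSquareIntegrableSeq X P ∧ HasTwoSidedLinearRegression b X P) := by
  have hsH : MemLp s ∞ AddCircle.haarAddCircle := memLp_haarAddCircle_iff.2 hs.1
  have hinv := memLp_top_inv hs.1 hess
  have hinvH : MemLp s⁻¹ ∞ AddCircle.haarAddCircle := memLp_haarAddCircle_iff.2 hinv
  have hposH := ae_haarAddCircle_iff.2 hpos
  have hne : ∀ᵐ t ∂(AddCircle.haarAddCircle : Measure TorusAngle), s t ≠ 0 := by
    filter_upwards [hposH] with t ht h0
    simp [h0] at ht
  have hinvpos : ∀ᵐ t ∂(AddCircle.haarAddCircle : Measure TorusAngle),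
      0 ≤ (s⁻¹ t).re ∧ (s⁻¹ t).im = 0 := by
    filter_upwards [hposH] with t ht
    rw [Pi.inv_apply, Complex.inv_re, Complex.inv_im, ht.2, neg_zero, zero_div]
    exact ⟨div_nonneg ht.1.le (Complex.normSq_nonneg _), rfl⟩
  have heven : (fun t => s⁻¹ (-t)) =ᵐ[AddCircle.haarAddCircle] s⁻¹ := by
    filter_upwards [ae_even_of_fourierCoeff_neg hsH (fourierCoeff_neg_of_isSymbol hs)] with t ht
    rw [Pi.inv_apply, Pi.inv_apply, ht]
  have hT : operatorMatrix (laurentOp hsH) = regressionMatrix b := by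
    rw [operatorMatrix_laurentOp, hs.2]
  have hS := operatorMatrix_laurentOp hinvH
  have hTS : (laurentOp hsH).comp (laurentOp hinvH) = ContinuousLinearMap.id ℂ EllTwoInt :=
    laurentOp_comp_eq_id hsH hinvH (hne.mono fun t ht => mul_inv_cancel₀ ht)
  have hST : (laurentOp hinvH).comp (laurentOp hsH) = ContinuousLinearMap.id ℂ EllTwoInt :=
    laurentOp_comp_eq_id hinvH hsH (hne.mono fun t ht => inv_mul_cancel₀ ht)
  obtain ⟨Ω, mΩ, P, X, hP, hX⟩ := exists_isCenteredGaussianSeq_laurentMatrix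
    (hinvH.integrable le_top) hinvpos
    (fourierCoeff_im_eq_zero (hinvpos.mono fun t ht => ht.2) heven)
  refine ⟨?_, ⟨hinv, laurentOp hsH, laurentOp hinvH, hT, hS, hTS, hST⟩, ⟨Ω, mΩ, P, X, hP, hX⟩, ?_⟩
  · have hX' := hX
    rw [← hS] at hX'
    -- Every diagonal entry of a Laurent matrix is the zeroth Fourier coefficient.
    have hvar : ∀ k, Var[X k; P] = Var[X 0; P] := by
      intro k
      apply Complex.ofReal_injective
      rw [← covariance_self (hX.measurable k).aemeasurable,
        ← covariance_self (hX.measurable 0).aemeasurable, hX.covariance_eq, hX.covariance_eq]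
      simp [laurentMatrix]
    have hv : 0 < Var[X 0; P] :=
      lt_of_le_of_ne (variance_nonneg _ _) (hX'.variance_ne_zero hT hST 0).symm
    obtain ⟨h1, h2⟩ := hX.normalized hv hvar
    exact ⟨Ω, mΩ, P, _, hP, h1, h2, (hX'.hasTwoSidedLinearRegression hT hST).const_mul
      (inv_ne_zero (Real.sqrt_pos.2 hv).ne')⟩
  · intro Ω _ P _ X hX
    refine ⟨hX.isSquareIntegrableSeq, ?_⟩
    rw [← hS] at hX
    exact hX.hasTwoSidedLinearRegression hT hST
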